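/- Let $\hbar\in\mathbb C$ be such that $e^{\hbar}$ is not a root of unity (so in particular $\sinh\hbar\neq 0$). Let $\widetilde U(\mathfrak{sl}_2)_\hbar$ be the universal Arens--Michael algebra generated by $E,F,H$ subject to the relations $$[H,E]=2E,\qquad [H,F]=-2F,\qquad [E,F]=\frac{\sinh(\hbar H)}{\sinh\hbar}.$$ Here algebras are unital complex associative algebras, and an Arens--Michael algebra is a complete Hausdorff topological algebra whose topology is determined by a system of submultiplicative seminorms. The word "universal" means that for any Arens--Michael algebra $B$ and any elements of $B$ satisfying the above relations there is a unique continuous (unital) homomorphism $\widetilde U(\mathfrak{sl}_2)_\hbar\to B$ sending $E,F,H$ to these elements. Then every continuous finite-dimensional representation of $\widetilde U(\mathfrak{sl}_2)_\hbar$ is completely reducible. That is, if $V$ is a finite-dimensional complex vector space with its usual topology and a unital left $\widetilde U(\mathfrak{sl}_2)_\hbar$-module structure, compatible with its complex vector space structure, such that the action $\widetilde U(\mathfrak{sl}_2)_\hbar\times V\to V$ is continuous, then every submodule of $V$ has a complementary submodule. -/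

import Mathlib

open Filter Topology

noncomputable section

namespace QuantumSl2

universe u

/-- An Arens-Michael algebra: a complete Hausdorff topological algebra over `ℂ` whose topology is
given by a family of submultiplicative seminorms. -/
structure IsArensMichael (B : Type u) [Ring B] [Algebra ℂ B] [UniformSpace B]
    [IsUniformAddGroup B] : Prop where
  t2 : T2Space B
  complete : CompleteSpace B
  seminorms : ∃ P : Set (Seminorm ℂ B),
    WithSeminorms (fun p : P => (p : Seminorm ℂ B)) ∧ ∀ p ∈ P, ∀ a b : B, p (a * b) ≤ p a * p b

theorem isTopologicalRing_of_submul {B : Type u} {ι : Type*} [Ring B] [Algebra ℂ B]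
    [TopologicalSpace B] {P : SeminormFamily ℂ B ι} (hP : WithSeminorms P)
    (hmul : ∀ i, ∀ a b : B, P i (a * b) ≤ P i a * P i b) : IsTopologicalRing B := by
  have := hP.topologicalAddGroup
  have : ContinuousMul B := by
    refine ⟨continuous_iff_continuousAt.2 ?_⟩
    rintro ⟨a, b⟩
    refine (hP.tendsto_nhds _ _).2 fun i ε hε => ?_
    have hc := hP.continuous_seminorm i
    have h : Tendsto (fun x : B × B => P i (x.1 - a) * P i x.2 + P i a * P i (x.2 - b))
        (𝓝 (a, b)) (𝓝 0) := by
      have : Continuous (fun x : B × B => P i (x.1 - a) * P i x.2 + P i a * P i (x.2 - b)) := by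
        fun_prop
      simpa using this.tendsto (a, b)
    filter_upwards [h.eventually (gt_mem_nhds hε)] with x hx
    refine lt_of_le_of_lt ?_ hx
    have e : x.1 * x.2 - a * b = (x.1 - a) * x.2 + a * (x.2 - b) := by noncomm_ring
    change P i (x.1 * x.2 - a * b) ≤ _
    rw [e]
    exact (map_add_le_add _ _ _).trans (add_le_add (hmul _ _ _) (hmul _ _ _))
  exact { }

/-- The relations `[H, E] = 2E`, `[H, F] = -2F`, `sinh ħ · [E, F] = sinh (ħH)` for three elements of
a topological algebra, where `sinh a` is the sum of the series `∑ a ^ (2n+1) / (2n+1)!`.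
When `sinh ħ ≠ 0` the last one is `[E, F] = sinh (ħH) / sinh ħ`. -/
structure IsTriple {B : Type u} [Ring B] [Algebra ℂ B] [TopologicalSpace B]
    (ħ : ℂ) (E F H : B) : Prop where
  relHE : H * E - E * H = (2 : ℂ) • E
  relHF : H * F - F * H = (-2 : ℂ) • F
  relEF : HasSum (fun n : ℕ => ((Nat.factorial (2 * n + 1) : ℂ)⁻¹) • (ħ • H) ^ (2 * n + 1))
    (Complex.sinh ħ • (E * F - F * E))

/-- Names of the three generators. -/
inductive Gen : Type
  | E | F | H

/-- The free unital associative algebra `ℂ⟨E, F, H⟩`, to be endowed with a topology that depends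
on `ħ`. -/
def PreU (_ħ : ℂ) : Type := FreeAlgebra ℂ Gen

namespace PreU

variable (ħ : ℂ)

instance : Ring (PreU ħ) := inferInstanceAs (Ring (FreeAlgebra ℂ Gen))

instance : Algebra ℂ (PreU ħ) := inferInstanceAs (Algebra ℂ (FreeAlgebra ℂ Gen))

/-- The generator of the free algebra with a given name. -/
def gen (g : Gen) : PreU ħ := FreeAlgebra.ι ℂ g

/-- A submultiplicative seminorm on the free algebra for which the defining relations hold,
i.e. they hold up to elements of seminorm zero and the series for `sinh (ħH)` converges with respect
to the seminorm to `sinh ħ · [E, F]`. -/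
structure Admissible (p : Seminorm ℂ (PreU ħ)) : Prop where
  submul : ∀ a b, p (a * b) ≤ p a * p b
  relHE : p (gen ħ .H * gen ħ .E - gen ħ .E * gen ħ .H - (2 : ℂ) • gen ħ .E) = 0
  relHF : p (gen ħ .H * gen ħ .F - gen ħ .F * gen ħ .H - (-2 : ℂ) • gen ħ .F) = 0
  relEF : Tendsto (fun s : Finset ℕ =>
      p (∑ n ∈ s, ((Nat.factorial (2 * n + 1) : ℂ)⁻¹) • (ħ • gen ħ .H) ^ (2 * n + 1)
        - Complex.sinh ħ • (gen ħ .E * gen ħ .F - gen ħ .F * gen ħ .E))) atTop (𝓝 0)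

/-- The family of all admissible seminorms. -/
def seminorms : SeminormFamily ℂ (PreU ħ) {p : Seminorm ℂ (PreU ħ) // Admissible ħ p} :=
  fun p => p.1

/-- The locally convex topology given by all admissible seminorms. -/
instance : TopologicalSpace (PreU ħ) := (seminorms ħ).moduleFilterBasis.topology

theorem withSeminorms : WithSeminorms (seminorms ħ) := ⟨rfl⟩

instance : IsTopologicalAddGroup (PreU ħ) := (withSeminorms ħ).topologicalAddGroup

instance : ContinuousSMul ℂ (PreU ħ) := (withSeminorms ħ).continuousSMul

instance : UniformSpace (PreU ħ) := IsTopologicalAddGroup.rightUniformSpace (PreU ħ)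

instance : IsUniformAddGroup (PreU ħ) := isUniformAddGroup_of_addCommGroup

instance : UniformContinuousConstSMul ℂ (PreU ħ) :=
  uniformContinuousConstSMul_of_continuousConstSMul ℂ (PreU ħ)

instance : IsTopologicalRing (PreU ħ) :=
  isTopologicalRing_of_submul (withSeminorms ħ) fun i => i.2.submul

end PreU

/-- The analytic form `Ũ(sl₂)_ħ`: the Hausdorff completion of the free algebra with respect to all
submultiplicative seminorms compatible with the defining relations. By `Utilde.isArensMichael`,
`Utilde.isTriple` and `Utilde.existsUnique_lift` it is the universal Arens-Michael algebra generated
by `E`, `F`, `H` subject to these relations. -/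
abbrev Utilde (ħ : ℂ) : Type := UniformSpace.Completion (PreU ħ)

namespace Utilde

open UniformSpace

variable (ħ : ℂ)

/-- The generators `E`, `F`, `H` of `Ũ(sl₂)_ħ`. -/
def gen (g : Gen) : Utilde ħ := ((PreU.gen ħ g : PreU ħ) : Completion (PreU ħ))

theorem tendsto_coe {α : Type*} {l : Filter α} (f : α → PreU ħ) (y : PreU ħ)
    (h : ∀ p : Seminorm ℂ (PreU ħ), PreU.Admissible ħ p →
      Tendsto (fun x => p (f x - y)) l (𝓝 0)) :
    Tendsto (fun x => (f x : Utilde ħ)) l (𝓝 (y : Utilde ħ)) := by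
  refine ((Completion.continuous_coe _).tendsto y).comp ?_
  refine ((PreU.withSeminorms ħ).tendsto_nhds _ _).2 fun i ε hε => ?_
  exact (h i.1 i.2).eventually (gt_mem_nhds hε)

theorem coe_eq (x y : PreU ħ) (h : ∀ p : Seminorm ℂ (PreU ħ), PreU.Admissible ħ p →
    p (x - y) = 0) : (x : Utilde ħ) = (y : Utilde ħ) := by
  have := tendsto_coe ħ (l := (atTop : Filter ℕ)) (fun _ => x) y fun p hp => by
    simp [h p hp]
  exact tendsto_nhds_unique tendsto_const_nhds this

/-- The generators satisfy the defining relations. -/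
theorem isTriple : IsTriple ħ (gen ħ .E) (gen ħ .F) (gen ħ .H) where
  relHE := by
    have := coe_eq ħ _ _ fun p hp => hp.relHE
    simpa [gen, Completion.coe_sub, Completion.coe_mul, Completion.coe_smul] using this
  relHF := by
    have := coe_eq ħ _ _ fun p hp => hp.relHF
    simpa only [gen, Completion.coe_sub, Completion.coe_mul, Completion.coe_smul] using this
  relEF := by
    have := tendsto_coe ħ _ _ fun p hp => hp.relEF
    have h2 : ∀ x : PreU ħ, (x : Utilde ħ) = Completion.coeRingHom x := fun _ => rfl
    have h3 : ∀ (c : ℂ) (x : PreU ħ), (Completion.coeRingHom (c • x) : Utilde ħ)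
      = c • Completion.coeRingHom x := fun c x => Completion.coe_smul c x
    simpa only [HasSum, SummationFilter.unconditional_filter, gen, h2, map_sum, map_sub, map_mul, map_pow, h3] using this

theorem uniformContinuous_seminorm (i : {p : Seminorm ℂ (PreU ħ) // PreU.Admissible ħ p}) :
    UniformContinuous i.1 :=
  Seminorm.uniformContinuous_of_continuousAt_zero
    ((PreU.withSeminorms ħ).continuous_seminorm i).continuousAt

theorem exists_extSeminorm (i : {p : Seminorm ℂ (PreU ħ) // PreU.Admissible ħ p}) :
    ∃ P : Seminorm ℂ (Utilde ħ), Continuous P ∧ ∀ x : PreU ħ, P (x : Utilde ħ) = i.1 x := by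
  obtain ⟨e, hc, he⟩ : ∃ e : Utilde ħ → ℝ, Continuous e ∧ ∀ x : PreU ħ, e x = i.1 x :=
    ⟨_, Completion.continuous_extension,
      Completion.extension_coe (uniformContinuous_seminorm ħ i)⟩
  refine ⟨Seminorm.of e (fun x y => ?_) (fun c x => ?_), hc, he⟩
  · refine Completion.induction_on₂ x y (isClosed_le ?_ ?_) fun a b => ?_
    · exact hc.comp continuous_add
    · exact (hc.comp continuous_fst).add (hc.comp continuous_snd)
    · rw [← Completion.coe_add, he, he, he]
      exact map_add_le_add _ _ _
  · refine Completion.induction_on x (isClosed_eq ?_ ?_) fun a => ?_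
    · exact hc.comp (continuous_const_smul c)
    · exact continuous_const.mul hc
    · rw [← Completion.coe_smul, he, he]
      exact map_smul_eq_mul _ _ _

/-- The extension of an admissible seminorm to the completion. -/
def extSeminorm (i : {p : Seminorm ℂ (PreU ħ) // PreU.Admissible ħ p}) :
    Seminorm ℂ (Utilde ħ) :=
  (exists_extSeminorm ħ i).choose

theorem extSeminorm_coe (i : {p : Seminorm ℂ (PreU ħ) // PreU.Admissible ħ p}) (x : PreU ħ) :
    extSeminorm ħ i (x : Utilde ħ) = i.1 x :=
  (exists_extSeminorm ħ i).choose_spec.2 x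

theorem continuous_extSeminorm (i : {p : Seminorm ℂ (PreU ħ) // PreU.Admissible ħ p}) :
    Continuous (extSeminorm ħ i) :=
  (exists_extSeminorm ħ i).choose_spec.1

theorem withSeminorms_ext : WithSeminorms (fun i => extSeminorm ħ i) := by
  rw [SeminormFamily.withSeminorms_iff_nhds_eq_iInf]
  refine le_antisymm (le_iInf fun i => ?_) ?_
  · rw [← tendsto_iff_comap]
    simpa using (continuous_extSeminorm ħ i).tendsto 0
  · intro U hU
    obtain ⟨C, hC, hCc, hCU⟩ := exists_mem_nhds_isClosed_subset hU
    have h1 : ((↑) : PreU ħ → Utilde ħ) ⁻¹' C ∈ 𝓝 (0 : PreU ħ) :=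
      (Completion.continuous_coe (PreU ħ)).continuousAt.preimage_mem_nhds
        (by rw [Completion.coe_zero]; exact hC)
    obtain ⟨s, r, hr, hs⟩ := ((PreU.withSeminorms ħ).mem_nhds_iff _ _).1 h1
    let O : Set (Utilde ħ) := ⋂ i ∈ s, {x | extSeminorm ħ i x < r}
    have hO : IsOpen O := isOpen_biInter_finset fun i _ =>
      isOpen_lt (continuous_extSeminorm ħ i) continuous_const
    have hOm : O ∈ ⨅ i, comap (extSeminorm ħ i) (𝓝 0) := by
      refine (biInter_finset_mem s).2 fun i _ => mem_iInf_of_mem i ?_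
      exact ⟨Set.Iio r, Iio_mem_nhds hr, fun _ h => h⟩
    refine mem_of_superset hOm fun x hx => hCU ?_
    have hd : Dense (Set.range ((↑) : PreU ħ → Utilde ħ)) := Completion.denseRange_coe
    have h2 := hd.open_subset_closure_inter hO hx
    refine closure_minimal ?_ hCc h2
    rintro _ ⟨hy, y, rfl⟩
    refine hs ?_
    rw [Seminorm.mem_ball, sub_zero]
    refine Seminorm.finset_sup_apply_lt hr fun i hi => ?_
    have := Set.mem_iInter₂.1 hy i hi
    rw [Set.mem_ofPred_eq, extSeminorm_coe] at this
    exact this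

/-- `Ũ(sl₂)_ħ` is an Arens-Michael algebra. -/
theorem isArensMichael : IsArensMichael (Utilde ħ) where
  t2 := inferInstance
  complete := inferInstance
  seminorms := by
    refine ⟨Set.range (extSeminorm ħ), ?_, ?_⟩
    · have h := withSeminorms_ext ħ
      rw [SeminormFamily.withSeminorms_iff_nhds_eq_iInf] at h ⊢
      rw [h]
      exact (iInf_range' (fun p : Seminorm ℂ (Utilde ħ) => comap p (𝓝 0)) _).symm
    · rintro _ ⟨i, rfl⟩ a b
      have hc := continuous_extSeminorm ħ i
      refine Completion.induction_on₂ a b (isClosed_le (hc.comp continuous_mul)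
        ((hc.comp continuous_fst).mul (hc.comp continuous_snd))) fun a b => ?_
      rw [← Completion.coe_mul, extSeminorm_coe, extSeminorm_coe, extSeminorm_coe]
      exact i.2.submul a b

/-- The universal property: for elements `E`, `F`, `H` of an Arens-Michael algebra that satisfy the
defining relations there is a unique continuous homomorphism sending the generators to them. -/
theorem existsUnique_lift {B : Type u} [Ring B] [Algebra ℂ B] [UniformSpace B]
    [IsUniformAddGroup B] (hB : IsArensMichael B) (E F H : B) (h : IsTriple ħ E F H) :
    ∃! φ : Utilde ħ →ₐ[ℂ] B, Continuous φ ∧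
      φ (gen ħ .E) = E ∧ φ (gen ħ .F) = F ∧ φ (gen ħ .H) = H := by
  have := hB.t2
  have := hB.complete
  obtain ⟨P, hP, hmul⟩ := hB.seminorms
  have := hP.continuousSMul
  have : IsTopologicalRing B := isTopologicalRing_of_submul hP fun i => hmul i.1 i.2
  let g : Gen → B := fun x => match x with
    | .E => E
    | .F => F
    | .H => H
  let f : PreU ħ →ₐ[ℂ] B := FreeAlgebra.lift ℂ g
  have fE : f (PreU.gen ħ .E) = E := FreeAlgebra.lift_ι_apply g Gen.E
  have fF : f (PreU.gen ħ .F) = F := FreeAlgebra.lift_ι_apply g Gen.F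
  have fH : f (PreU.gen ħ .H) = H := FreeAlgebra.lift_ι_apply g Gen.H
  have hadm : ∀ p ∈ P, PreU.Admissible ħ (p.comp f.toLinearMap) := by
    intro p hp
    have hpc : Continuous p := hP.continuous_seminorm ⟨p, hp⟩
    refine ⟨fun a b => ?_, ?_, ?_, ?_⟩
    · simpa using hmul p hp (f a) (f b)
    · simp [fE, fH, h.relHE]
    · simpa [fF, fH] using by simp [h.relHF]
    · have h1 := h.relEF.sub_const (Complex.sinh ħ • (E * F - F * E))
      have h2 := (hpc.tendsto _).comp h1
      simpa [Function.comp_def, fE, fF, fH] using h2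
  have hf : Continuous f := by
    have := continuous_of_continuousAt_zero f.toLinearMap.toAddMonoidHom ?_
    · exact this
    · rw [ContinuousAt, map_zero]
      refine (hP.tendsto_nhds _ _).2 fun i ε hε => ?_
      have hc := (PreU.withSeminorms ħ).continuous_seminorm ⟨_, hadm i.1 i.2⟩
      have := hc.tendsto 0
      rw [map_zero] at this
      filter_upwards [this.eventually (gt_mem_nhds hε)] with x hx
      simpa [PreU.seminorms] using hx
  have hext : ∀ x : PreU ħ, Completion.extensionHom f.toRingHom hf (x : Utilde ħ) = f x :=
    fun x => Completion.extensionHom_coe f.toRingHom hf x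
  let φ : Utilde ħ →ₐ[ℂ] B :=
    { Completion.extensionHom f.toRingHom hf with
      commutes' := fun r => by
        change Completion.extensionHom f.toRingHom hf (algebraMap ℂ (Utilde ħ) r) = _
        rw [Completion.algebraMap_def, hext]
        exact f.commutes r }
  have hφc : Continuous φ := (Completion.continuous_extension : Continuous (Completion.extension f))
  refine ⟨φ, ⟨hφc, (hext _).trans fE, (hext _).trans fF, (hext _).trans fH⟩, ?_⟩
  rintro ψ ⟨hψc, hE, hF, hH⟩
  let c : PreU ħ →ₐ[ℂ] Utilde ħ :=
    { (Completion.coeRingHom : PreU ħ →+* Utilde ħ) with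
      commutes' := fun r => (Completion.algebraMap_def (A := PreU ħ) (R := ℂ) r).symm }
  have hcomp : (ψ.comp c : FreeAlgebra ℂ Gen →ₐ[ℂ] B) = f := by
    refine FreeAlgebra.hom_ext (funext fun x => ?_)
    cases x
    · exact hE.trans fE.symm
    · exact hF.trans fF.symm
    · exact hH.trans fH.symm
  ext x
  refine Completion.induction_on x (isClosed_eq hψc hφc) fun a => ?_
  exact (DFunLike.congr_fun hcomp a).trans (hext a).symm

end Utilde

end QuantumSl2

end

/-! Call `v` a highest weight vector if `E v = 0` and `H v = l • v`. Two facts give semisimplicity: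
a nonzero such `v` generates a simple submodule (`isSimpleModule_span_highestWeight`), and the
vectors `F ^ j v` span `V` (`highestWeightSpan_eq_top`). Hence `V` is a sum of simple submodules; no
Casimir element is needed.

Everything rests on `raise_lower`: up to the factor `sinh ħ ^ 2`, `E` sends `F ^ (k+1) v` to `sinh
(ħ(k+1)) sinh (ħ(l-k)) • F ^ k v`. Since `e ^ ħ` is not a root of unity, this coefficient vanishes
for at most one `k`, and as a function of `l` it has simple zeros. Simplicity of the zeros forbids
Jordan blocks of `H` on `ker E`, so `ker E` is spanned by highest weight vectors.

For spanning, let `W` be the span of all `F ^ j v`. If `W ≠ ⊤`, some `u ∉ W` of generalized weight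
`l` becomes a highest weight vector in `V ⧸ W`. This restricts `l` enough that `E` maps the weight
`l` part of `W` onto its weight `l + 2` part. Thus `E u = E y` with `y ∈ W`, so `u - y ∈ ker E ≤ W`,
a contradiction. -/

namespace QuantumSl2

open Module UniformSpace

/-! ### Hyperbolic identities and the root of unity condition -/

section Scalar

variable {ħ : ℂ}

theorem int_eq_zero_of_sinh_mul_eq_zero (hħ : ∀ n : ℕ, 0 < n → Complex.exp ħ ^ n ≠ 1) (m : ℤ)
    (h : Complex.sinh (ħ * m) = 0) : m = 0 := by
  by_contra hm
  have h1 : Complex.exp (ħ * m) = Complex.exp (-(ħ * m)) := by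
    rw [Complex.sinh, div_eq_zero_iff] at h
    exact sub_eq_zero.1 (h.resolve_right two_ne_zero)
  have h2 : Complex.exp (((2 * m : ℤ) : ℂ) * ħ) = 1 := by
    have e : ((2 * m : ℤ) : ℂ) * ħ = ħ * m + ħ * m := by push_cast; ring
    rw [e, Complex.exp_add]
    nth_rewrite 1 [h1]
    rw [← Complex.exp_add, neg_add_cancel, Complex.exp_zero]
  rw [Complex.exp_int_mul] at h2
  refine hħ (2 * m).natAbs (by omega) ?_
  rcases Int.natAbs_eq (2 * m) with h3 | h3
  · rw [h3, zpow_natCast] at h2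
    exact h2
  · rw [h3, zpow_neg, zpow_natCast, inv_eq_one] at h2
    exact h2

theorem sinh_ne_zero (hħ : ∀ n : ℕ, 0 < n → Complex.exp ħ ^ n ≠ 1) : Complex.sinh ħ ≠ 0 := by
  intro h
  have := int_eq_zero_of_sinh_mul_eq_zero hħ 1 (by simpa using h)
  omega

/-- Highest weights need not be integers, only integers modulo `πi/ħ`. By the addition formula that
integer is well defined, which is what all weight comparisons below use. -/
theorem int_eq_of_sinh_eq_zero (hħ : ∀ n : ℕ, 0 < n → Complex.exp ħ ^ n ≠ 1) {l : ℂ} {a b : ℤ}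
    (ha : Complex.sinh (ħ * (l - a)) = 0) (hb : Complex.sinh (ħ * (l - b)) = 0) : a = b := by
  have h := int_eq_zero_of_sinh_mul_eq_zero hħ (b - a) (by
    have e : ħ * ((b - a : ℤ) : ℂ) = ħ * (l - a) - ħ * (l - b) := by push_cast; ring
    rw [e, Complex.sinh_sub, ha, hb]
    ring)
  omega

/-- The coefficient `A` in `sinh ħ · E F^(k+1) v = A F^k v` for a highest weight vector `v`, up to
one more factor `sinh ħ`. -/
noncomputable def raiseCoeff (ħ l : ℂ) (k : ℕ) : ℂ :=
  Complex.sinh (ħ * (k + 1)) * Complex.sinh (ħ * (l - k))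

/-- The derivative of `raiseCoeff` with respect to the weight. -/
noncomputable def raiseCoeffDeriv (ħ l : ℂ) (k : ℕ) : ℂ :=
  Complex.sinh (ħ * (k + 1)) * (ħ * Complex.cosh (ħ * (l - k)))

/-- The increment is the scalar by which `sinh ħ • sinh (ħH)` acts at weight `l - 2(k+1)`, so these
coefficients are the telescoped sums of commutators. -/
theorem raiseCoeff_succ (ħ l : ℂ) (k : ℕ) : raiseCoeff ħ l (k + 1) =
    raiseCoeff ħ l k + Complex.sinh ħ * Complex.sinh (ħ * (l - 2 * ((k + 1 : ℕ) : ℂ))) := by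
  have e1 : ħ * (((k + 1 : ℕ) : ℂ) + 1) = ħ * (k + 1) + ħ := by push_cast; ring
  have e2 : ħ * (l - k) = ħ * (l - (k + 1)) + ħ := by ring
  have e3 : ħ * (l - 2 * ((k + 1 : ℕ) : ℂ)) = ħ * (l - (k + 1)) - ħ * (k + 1) := by
    push_cast; ring
  rw [raiseCoeff, raiseCoeff, e1, e2, e3]
  push_cast
  rw [Complex.sinh_add, Complex.sinh_add, Complex.sinh_sub]
  ring

theorem raiseCoeffDeriv_succ (ħ l : ℂ) (k : ℕ) : raiseCoeffDeriv ħ l (k + 1) =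
    raiseCoeffDeriv ħ l k +
      Complex.sinh ħ * (ħ * Complex.cosh (ħ * (l - 2 * ((k + 1 : ℕ) : ℂ)))) := by
  have e1 : ħ * (((k + 1 : ℕ) : ℂ) + 1) = ħ * (k + 1) + ħ := by push_cast; ring
  have e2 : ħ * (l - k) = ħ * (l - (k + 1)) + ħ := by ring
  have e3 : ħ * (l - 2 * ((k + 1 : ℕ) : ℂ)) = ħ * (l - (k + 1)) - ħ * (k + 1) := by
    push_cast; ring
  rw [raiseCoeffDeriv, raiseCoeffDeriv, e1, e2, e3]
  push_cast
  rw [Complex.sinh_add, Complex.cosh_add, Complex.cosh_sub]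
  ring

theorem sinh_mul_succ_ne_zero (hħ : ∀ n : ℕ, 0 < n → Complex.exp ħ ^ n ≠ 1) (k : ℕ) :
    Complex.sinh (ħ * (k + 1)) ≠ 0 := by
  intro h
  have := int_eq_zero_of_sinh_mul_eq_zero hħ (k + 1) (by simpa using h)
  omega

theorem raiseCoeff_eq_zero_iff (hħ : ∀ n : ℕ, 0 < n → Complex.exp ħ ^ n ≠ 1) {l : ℂ} {k : ℕ} :
    raiseCoeff ħ l k = 0 ↔ Complex.sinh (ħ * (l - k)) = 0 := by
  simp [raiseCoeff, sinh_mul_succ_ne_zero hħ k]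

/-- Zeros in `l` are simple because `cosh ^ 2 - sinh ^ 2 = 1`. -/
theorem raiseCoeffDeriv_ne_zero (hħ : ∀ n : ℕ, 0 < n → Complex.exp ħ ^ n ≠ 1) {l : ℂ} {k : ℕ}
    (h : raiseCoeff ħ l k = 0) : raiseCoeffDeriv ħ l k ≠ 0 := by
  rw [raiseCoeff_eq_zero_iff hħ] at h
  have h0 : ħ ≠ 0 := by
    rintro rfl
    exact sinh_ne_zero hħ Complex.sinh_zero
  have hc : Complex.cosh (ħ * (l - k)) ≠ 0 := by
    intro hc
    have := Complex.cosh_sq_sub_sinh_sq (ħ * (l - k))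
    rw [h, hc] at this
    norm_num at this
  simp [raiseCoeffDeriv, sinh_mul_succ_ne_zero hħ k, h0, hc]

end Scalar

/-- Operators `E`, `F`, `H` on a topological vector space that satisfy the defining relations, the
series for `sinh (ħH)` being convergent pointwise. -/
structure IsOpTriple {V : Type*} [AddCommGroup V] [Module ℂ V] [TopologicalSpace V]
    (ħ : ℂ) (E F H : End ℂ V) : Prop where
  relHE : H * E - E * H = (2 : ℂ) • E
  relHF : H * F - F * H = (-2 : ℂ) • F
  relEF : ∀ v, HasSum
    (fun n : ℕ => ((Nat.factorial (2 * n + 1) : ℂ)⁻¹) • ((ħ • H) ^ (2 * n + 1)) v)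
    (Complex.sinh ħ • (E * F - F * E) v)

/-! ### Generalized weight spaces -/

section Weights

variable {V : Type*} [AddCommGroup V] [Module ℂ V]

theorem sub_smul_pow_apply_shift {H X : End ℂ V} {c : ℂ} (h : H * X - X * H = c • X) (l : ℂ)
    (n : ℕ) (v : V) :
    ((H - (l + c) • (1 : End ℂ V)) ^ n) (X v) = X (((H - l • (1 : End ℂ V)) ^ n) v) := by
  have h1 : (H - (l + c) • (1 : End ℂ V)) * X = X * (H - l • (1 : End ℂ V)) := by
    rw [sub_mul, mul_sub, add_smul, add_mul, smul_mul_assoc, smul_mul_assoc, one_mul,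
      mul_smul_comm, mul_one, ← h]
    abel
  have h2 : SemiconjBy X (H - l • (1 : End ℂ V)) (H - (l + c) • (1 : End ℂ V)) := h1.symm
  exact (DFunLike.congr_fun (h2.pow_right n) v).symm

theorem apply_mem_maxGenEigenspace {H X : End ℂ V} {c : ℂ} (h : H * X - X * H = c • X) {l : ℂ}
    {v : V} (hv : v ∈ H.maxGenEigenspace l) : X v ∈ H.maxGenEigenspace (l + c) := by
  rw [End.mem_maxGenEigenspace] at hv ⊢
  obtain ⟨n, hn⟩ := hv
  exact ⟨n, by rw [sub_smul_pow_apply_shift h, hn, map_zero]⟩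

theorem pow_apply_mem_maxGenEigenspace {H X : End ℂ V} {c : ℂ} (h : H * X - X * H = c • X) {l : ℂ}
    {v : V} (hv : v ∈ H.maxGenEigenspace l) (k : ℕ) :
    (X ^ k) v ∈ H.maxGenEigenspace (l + k * c) := by
  induction k with
  | zero => simpa using hv
  | succ k ih =>
    have := apply_mem_maxGenEigenspace h ih
    rw [pow_succ', Module.End.mul_apply]
    convert this using 2
    push_cast
    ring

/-- Otherwise the independent generalized eigenspaces at `l + k * c` would be nonzero for every `k`.
-/
theorem exists_pow_apply_eq_zero [FiniteDimensional ℂ V] {H X : End ℂ V} {c : ℂ} (hc : c ≠ 0)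
    (h : H * X - X * H = c • X) {l : ℂ} {v : V} (hv : v ∈ H.maxGenEigenspace l) :
    ∃ k, (X ^ k) v = 0 := by
  by_contra! hne
  have hfin := WellFoundedGT.finite_ne_bot_of_iSupIndep H.independent_maxGenEigenspace
  refine Set.infinite_of_injective_forall_mem (f := fun k : ℕ => l + k * c) ?_ ?_ hfin
  · intro a b hab
    simpa [hc] using hab
  · intro k
    exact (Submodule.ne_bot_iff _).2 ⟨_, pow_apply_mem_maxGenEigenspace h hv k, hne k⟩

/-- Eigenvectors are shifted by the lowering operator. -/
theorem apply_pow_lower {H F : End ℂ V} (h : H * F - F * H = (-2 : ℂ) • F) {l : ℂ} {v w : V}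
    (hv : H v = l • v + w) (k : ℕ) :
    H ((F ^ k) v) = (l - 2 * (k : ℂ)) • (F ^ k) v + (F ^ k) w := by
  induction k with
  | zero => simpa using hv
  | succ k ih =>
    have h1 := DFunLike.congr_fun h ((F ^ k) v)
    simp only [LinearMap.sub_apply, Module.End.mul_apply, LinearMap.smul_apply] at h1
    rw [pow_succ', Module.End.mul_apply, Module.End.mul_apply, sub_eq_iff_eq_add.1 h1, ih, map_add,
      map_smul]
    push_cast
    module

end Weights

/-! ### The commutator of `E` and `F` on Jordan blocks of size at most two -/

section Bracket

variable {V : Type*} [AddCommGroup V] [Module ℂ V]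

theorem smul_pow_apply {ħ l : ℂ} {H : End ℂ V} {v w : V} (hv : H v = l • v + w) (hw : H w = l • w)
    (n : ℕ) : ((ħ • H) ^ (n + 1)) v = (ħ * l) ^ (n + 1) • v + ((n + 1) * ħ * (ħ * l) ^ n) • w := by
  have hw' : ∀ n : ℕ, ((ħ • H) ^ n) w = (ħ * l) ^ n • w := by
    intro n
    induction n with
    | zero => simp
    | succ n ih =>
      rw [pow_succ', Module.End.mul_apply, ih, map_smul, LinearMap.smul_apply, hw]
      module
  induction n with
  | zero => simp [hv, smul_smul]
  | succ n ih =>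
    rw [pow_succ', Module.End.mul_apply, ih, map_add, map_smul, map_smul, LinearMap.smul_apply,
      LinearMap.smul_apply, hv, hw]
    push_cast
    module

variable [TopologicalSpace V] [IsTopologicalAddGroup V] [ContinuousSMul ℂ V] [T2Space V]

/-- A power series in `ħH` acts on such a block by its value at `ħl` plus its `l`-derivative times
the nilpotent part. -/
theorem IsOpTriple.sinh_smul_bracket {ħ : ℂ} {E F H : End ℂ V} (T : IsOpTriple ħ E F H) {l : ℂ}
    {v w : V} (hv : H v = l • v + w) (hw : H w = l • w) :
    Complex.sinh ħ • (E (F v) - F (E v)) =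
      Complex.sinh (ħ * l) • v + (ħ * Complex.cosh (ħ * l)) • w := by
  have h1 := ((Complex.hasSum_sinh (ħ * l)).smul_const v).add
    (((Complex.hasSum_cosh (ħ * l)).mul_left ħ).smul_const w)
  refine (T.relEF v).unique ?_
  convert h1 using 2 with n
  rw [smul_pow_apply hv hw, smul_add, smul_smul, smul_smul, Nat.factorial_succ]
  have : (Nat.factorial (2 * n) : ℂ) ≠ 0 := by exact_mod_cast Nat.factorial_ne_zero _
  have h2 : (2 * (n : ℂ) + 1) ≠ 0 := by exact_mod_cast Nat.succ_ne_zero (2 * n)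
  congr 2
  · field_simp
  · push_cast
    field_simp

/-- Commute `E` past one `F` at a time; `E v = 0` kills the last term. -/
theorem IsOpTriple.raise_lower {ħ : ℂ} {E F H : End ℂ V} (T : IsOpTriple ħ E F H) {l : ℂ}
    {v w : V} (hv : H v = l • v + w) (hw : H w = l • w) (hEv : E v = 0) (k : ℕ) :
    (Complex.sinh ħ * Complex.sinh ħ) • E ((F ^ (k + 1)) v) =
      raiseCoeff ħ l k • (F ^ k) v + raiseCoeffDeriv ħ l k • (F ^ k) w := by
  have hb : ∀ k : ℕ, Complex.sinh ħ • (E ((F ^ (k + 1)) v) - F (E ((F ^ k) v))) =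
      Complex.sinh (ħ * (l - 2 * (k : ℂ))) • (F ^ k) v
        + (ħ * Complex.cosh (ħ * (l - 2 * (k : ℂ)))) • (F ^ k) w := by
    intro k
    rw [pow_succ', Module.End.mul_apply]
    refine T.sinh_smul_bracket (apply_pow_lower T.relHF hv k) ?_
    simpa using apply_pow_lower T.relHF (w := 0) (by simpa using hw) k
  induction k with
  | zero =>
    have := hb 0
    simp only [pow_zero, Module.End.one_apply, hEv, map_zero, sub_zero] at this
    rw [mul_smul, this]
    simp [raiseCoeff, raiseCoeffDeriv, mul_smul]
  | succ k ih =>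
    have h1 := congrArg F ih
    simp only [map_add, map_smul] at h1
    simp only [← Module.End.mul_apply F, ← pow_succ'] at h1
    have h2 := congrArg (Complex.sinh ħ • ·) (hb (k + 1))
    simp only [smul_smul, smul_sub, smul_add] at h2
    rw [Module.End.mul_apply] at h1
    rw [h1] at h2
    rw [sub_eq_iff_eq_add.1 h2, raiseCoeff_succ, raiseCoeffDeriv_succ]
    module

end Bracket

/-! ### Weight vectors and quotients -/

section Basic

variable {V : Type*} [AddCommGroup V] [Module ℂ V]

theorem mem_maxGenEigenspace_of_apply {H : End ℂ V} {l : ℂ} {v : V} (hv : H v = l • v) :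
    v ∈ H.maxGenEigenspace l :=
  End.eigenspace_le_maxGenEigenspace (End.mem_eigenspace_iff.2 hv)

variable [TopologicalSpace V] {ħ : ℂ} {E F H : End ℂ V}

theorem IsOpTriple.apply_pow_lower_eigen (T : IsOpTriple ħ E F H) {l : ℂ} {v : V}
    (hv : H v = l • v) (k : ℕ) : H ((F ^ k) v) = (l - 2 * (k : ℂ)) • (F ^ k) v := by
  simpa using apply_pow_lower T.relHF (w := 0) (by simpa using hv) k

theorem IsOpTriple.quotient (T : IsOpTriple ħ E F H) {W : Submodule ℂ V}
    (hE : W ≤ W.comap E) (hF : W ≤ W.comap F) (hH : W ≤ W.comap H) :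
    IsOpTriple ħ (W.mapQ W E hE) (W.mapQ W F hF) (W.mapQ W H hH) where
  relHE := by
    ext v
    have := congrArg W.mkQ (DFunLike.congr_fun T.relHE v)
    simpa using this
  relHF := by
    ext v
    have := congrArg W.mkQ (DFunLike.congr_fun T.relHF v)
    simpa using this
  relEF := by
    intro v
    obtain ⟨v, rfl⟩ := W.mkQ_surjective v
    have hp : ∀ n, ((ħ • W.mapQ W H hH) ^ n) (W.mkQ v) = W.mkQ (((ħ • H) ^ n) v) := by
      intro n
      induction n with
      | zero => simp
      | succ n ih =>
        rw [pow_succ', pow_succ', Module.End.mul_apply, Module.End.mul_apply, ih]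
        simp
    have := W.mkQL.hasSum (T.relEF v)
    simp only [hp]
    simpa using this

end Basic

/-! ### Highest weight vectors and the space they span -/

section HighestWeight

variable {V : Type*} [AddCommGroup V] [Module ℂ V]
  [TopologicalSpace V] [IsTopologicalAddGroup V] [ContinuousSMul ℂ V] [T2Space V]
  {ħ : ℂ} {E F H : End ℂ V}

/-- `P` is the product of the raising coefficients and `Q` its `l`-derivative by the product rule;
`c` collects powers of `sinh ħ`. At most one factor vanishes, and only to first order, so `P` and
`Q` are never both zero. -/
theorem IsOpTriple.raise_pow_lower_pow (T : IsOpTriple ħ E F H)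
    (hħ : ∀ n : ℕ, 0 < n → Complex.exp ħ ^ n ≠ 1) {l : ℂ} {v w : V}
    (hv : H v = l • v + w) (hw : H w = l • w) (hEv : E v = 0) (hEw : E w = 0) (k : ℕ) :
    ∃ P Q c : ℂ, c • (E ^ k) ((F ^ k) v) = P • v + Q • w ∧ c • (E ^ k) ((F ^ k) w) = P • w ∧
      (P = 0 → Q ≠ 0 ∧ ∃ n < k, Complex.sinh (ħ * (l - (n : ℕ))) = 0) := by
  induction k with
  | zero => exact ⟨1, 0, 1, by simp, by simp, by simp⟩
  | succ k ih =>
    obtain ⟨P, Q, c, h1, h2, h3⟩ := ih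
    have r1 := T.raise_lower hv hw hEv k
    have r2 := T.raise_lower (w := 0) (by simpa using hw) (by simp) hEw k
    rw [map_zero, smul_zero, add_zero] at r2
    refine ⟨raiseCoeff ħ l k * P, raiseCoeff ħ l k * Q + raiseCoeffDeriv ħ l k * P,
      c * (Complex.sinh ħ * Complex.sinh ħ), ?_, ?_, ?_⟩
    · rw [pow_succ E, Module.End.mul_apply, mul_smul, ← map_smul, r1, map_add, map_smul, map_smul,
        smul_add, smul_comm c, smul_comm c, h1, h2]
      module
    · rw [pow_succ E, Module.End.mul_apply, mul_smul, ← map_smul, r2, map_smul,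
        smul_comm c, h2, smul_smul]
    · intro h0
      by_cases hP : P = 0
      · obtain ⟨hQ, n, hn, hs⟩ := h3 hP
        refine ⟨?_, n, hn.trans (Nat.lt_succ_self k), hs⟩
        have : raiseCoeff ħ l k ≠ 0 := by
          intro hA
          rw [raiseCoeff_eq_zero_iff hħ] at hA
          have := int_eq_of_sinh_eq_zero hħ (a := n) (b := k) (by simpa using hs) (by simpa using hA)
          omega
        simp [hP, this, hQ]
      · have hA : raiseCoeff ħ l k = 0 := (mul_eq_zero.1 h0).resolve_right hP
        refine ⟨?_, k, Nat.lt_succ_self k, (raiseCoeff_eq_zero_iff hħ).1 hA⟩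
        simp [hA, hP, raiseCoeffDeriv_ne_zero hħ hA]

theorem IsOpTriple.raise_lower_eigen (T : IsOpTriple ħ E F H) {l : ℂ} {v : V}
    (hv : H v = l • v) (hEv : E v = 0) (k : ℕ) :
    (Complex.sinh ħ * Complex.sinh ħ) • E ((F ^ (k + 1)) v) = raiseCoeff ħ l k • (F ^ k) v := by
  simpa using T.raise_lower (w := 0) (by simpa using hv) (by simp) hEv k

variable [FiniteDimensional ℂ V]

/-- The weight of a highest weight vector. -/
theorem IsOpTriple.exists_sinh_eq_zero (T : IsOpTriple ħ E F H)
    (hħ : ∀ n : ℕ, 0 < n → Complex.exp ħ ^ n ≠ 1) {l : ℂ} {v : V} (h0 : v ≠ 0)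
    (hv : H v = l • v) (hEv : E v = 0) : ∃ n : ℕ, Complex.sinh (ħ * (l - n)) = 0 := by
  obtain ⟨k, hk⟩ := exists_pow_apply_eq_zero (by norm_num) T.relHF
    (mem_maxGenEigenspace_of_apply hv)
  obtain ⟨P, Q, c, h1, -, h3⟩ := T.raise_pow_lower_pow hħ (w := 0) (by simpa using hv) (by simp)
    hEv (by simp) k
  rw [hk] at h1
  have hP : P = 0 := by simpa [h0, eq_comm] using h1
  obtain ⟨-, n, -, hn⟩ := h3 hP
  exact ⟨n, hn⟩

/-- `E` kills `F ^ (n+1) v`. Were it nonzero, it would have highest weight `l - 2(n+1)`, forcing `n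
= 2(n+1) + m` with `m ≥ 0`. -/
theorem IsOpTriple.pow_lower_eq_zero (T : IsOpTriple ħ E F H)
    (hħ : ∀ n : ℕ, 0 < n → Complex.exp ħ ^ n ≠ 1) {l : ℂ} {v : V}
    (hv : H v = l • v) (hEv : E v = 0) {n : ℕ} (hn : Complex.sinh (ħ * (l - n)) = 0) :
    (F ^ (n + 1)) v = 0 := by
  by_contra hne
  have hE : E ((F ^ (n + 1)) v) = 0 := by
    have := T.raise_lower_eigen hv hEv n
    rw [(raiseCoeff_eq_zero_iff hħ).2 hn, zero_smul] at this
    simpa [sinh_ne_zero hħ] using this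
  obtain ⟨m, hm⟩ := T.exists_sinh_eq_zero hħ hne (T.apply_pow_lower_eigen hv (n + 1)) hE
  have := int_eq_of_sinh_eq_zero hħ (l := l) (a := n) (b := 2 * (n + 1) + m) (by simpa using hn)
    (by rw [← hm]; push_cast; ring_nf)
  omega

/-- `H` acts semisimply on the kernel of `E`. -/
theorem IsOpTriple.eq_zero_of_jordan (T : IsOpTriple ħ E F H)
    (hħ : ∀ n : ℕ, 0 < n → Complex.exp ħ ^ n ≠ 1) {l : ℂ} {v w : V}
    (hv : H v = l • v + w) (hw : H w = l • w) (hEv : E v = 0) : w = 0 := by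
  by_contra hne
  have hEw : E w = 0 := by
    have h1 := DFunLike.congr_fun T.relHE v
    simp only [LinearMap.sub_apply, Module.End.mul_apply, LinearMap.smul_apply, hEv, hv, map_add,
      map_smul] at h1
    simpa using h1
  have hvm : v ∈ H.maxGenEigenspace l := by
    rw [End.mem_maxGenEigenspace]
    refine ⟨2, ?_⟩
    simp [pow_two, hv, hw]
  obtain ⟨k, hk⟩ := exists_pow_apply_eq_zero (by norm_num) T.relHF hvm
  -- `F ^ k w` is `H - (l - 2k)` applied to `F ^ k v = 0`.
  have hkw : (F ^ k) w = 0 := by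
    have := apply_pow_lower T.relHF hv k
    simpa [hk, eq_comm] using this
  obtain ⟨P, Q, c, h1, h2, h3⟩ := T.raise_pow_lower_pow hħ hv hw hEv hEw k
  rw [hkw] at h2
  have hP : P = 0 := by simpa [hne, eq_comm] using h2
  rw [hk, hP] at h1
  have hQ : Q = 0 := by simpa [hne, eq_comm] using h1
  exact (h3 hP).1 hQ

theorem IsOpTriple.eigen_of_mem_maxGenEigenspace (T : IsOpTriple ħ E F H)
    (hħ : ∀ n : ℕ, 0 < n → Complex.exp ħ ^ n ≠ 1) {l : ℂ} {v : V}
    (hv : v ∈ H.maxGenEigenspace l) (hEv : E v = 0) : H v = l • v := by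
  rw [End.mem_maxGenEigenspace] at hv
  obtain ⟨n, hn⟩ := hv
  set N : End ℂ V := H - l • (1 : End ℂ V) with hN
  have hNa : ∀ x, N x = H x - l • x := fun x => by simp [hN]
  suffices h : ∀ n : ℕ, ∀ v : V, E v = 0 → (N ^ n) v = 0 → N v = 0 by
    have := h n v hEv hn
    rwa [hNa, sub_eq_zero] at this
  clear hn hEv v n
  intro n
  induction n with
  | zero =>
    intro v _ h
    have : v = 0 := by simpa using h
    simp [this]
  | succ n ih =>
    intro v hEv hn
    rw [pow_succ, Module.End.mul_apply] at hn
    have hEN : E (N v) = 0 := by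
      have h1 := DFunLike.congr_fun T.relHE v
      simp only [LinearMap.sub_apply, Module.End.mul_apply, LinearMap.smul_apply, hEv,
        map_zero, smul_zero, zero_sub, neg_eq_zero] at h1
      simp [hNa, h1, hEv]
    have h2 := ih (N v) hEN hn
    rw [hNa (N v), sub_eq_zero] at h2
    exact T.eq_zero_of_jordan hħ (by rw [hNa]; abel) h2 hEv

/-- The span of all `F ^ j v`, where `v` is a highest weight vector. -/
def highestWeightSpan (E F H : End ℂ V) : Submodule ℂ V :=
  Submodule.span ℂ {x | ∃ (v : V) (l : ℂ) (j : ℕ), H v = l • v ∧ E v = 0 ∧ x = (F ^ j) v}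

/-- `ker E` is `H`-stable, hence the sum of its generalized weight parts, which consist of true
eigenvectors. -/
theorem IsOpTriple.ker_le_highestWeightSpan (T : IsOpTriple ħ E F H)
    (hħ : ∀ n : ℕ, 0 < n → Complex.exp ħ ^ n ≠ 1) :
    LinearMap.ker E ≤ highestWeightSpan E F H := by
  have hinv : ∀ x ∈ LinearMap.ker E, H x ∈ LinearMap.ker E := by
    intro x hx
    rw [LinearMap.mem_ker] at hx ⊢
    have h1 := DFunLike.congr_fun T.relHE x
    simpa only [LinearMap.sub_apply, Module.End.mul_apply, LinearMap.smul_apply, hx,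
      map_zero, smul_zero, zero_sub, neg_eq_zero] using h1
  have h1 := Submodule.inf_iSup_genEigenspace hinv (k := ⊤)
  rw [show (⨆ μ, H.genEigenspace μ ⊤) = ⊤ from End.iSup_maxGenEigenspace_eq_top H, inf_top_eq] at h1
  rw [h1]
  refine iSup_le fun l x hx => Submodule.subset_span ⟨x, l, 0, ?_, hx.1, by simp⟩
  exact T.eigen_of_mem_maxGenEigenspace hħ hx.2 hx.1

theorem IsOpTriple.highestWeightSpan_eq_top (T : IsOpTriple ħ E F H)
    (hħ : ∀ n : ℕ, 0 < n → Complex.exp ħ ^ n ≠ 1) : highestWeightSpan E F H = ⊤ := by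
  set W := highestWeightSpan E F H with hW
  have hs : Complex.sinh ħ * Complex.sinh ħ ≠ 0 := mul_ne_zero (sinh_ne_zero hħ) (sinh_ne_zero hħ)
  have hsub : ∀ (v : V) (l : ℂ) (j : ℕ), H v = l • v → E v = 0 → (F ^ j) v ∈ W :=
    fun v l j h1 h2 => Submodule.subset_span ⟨v, l, j, h1, h2, rfl⟩
  have hE : W ≤ W.comap E := by
    refine Submodule.span_le.2 ?_
    rintro _ ⟨v, l, j, h1, h2, rfl⟩
    rcases j with _ | j
    · simp [h2]
    · have := T.raise_lower_eigen h1 h2 j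
      have h3 : (Complex.sinh ħ * Complex.sinh ħ) • E ((F ^ (j + 1)) v) ∈ W := by
        rw [this]
        exact W.smul_mem _ (hsub v l j h1 h2)
      exact (W.smul_mem_iff hs).1 h3
  have hF : W ≤ W.comap F := by
    refine Submodule.span_le.2 ?_
    rintro _ ⟨v, l, j, h1, h2, rfl⟩
    have := hsub v l (j + 1) h1 h2
    rwa [pow_succ', Module.End.mul_apply] at this
  have hH : W ≤ W.comap H := by
    refine Submodule.span_le.2 ?_
    rintro _ ⟨v, l, j, h1, h2, rfl⟩
    change H _ ∈ W
    rw [T.apply_pow_lower_eigen h1]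
    exact W.smul_mem _ (hsub v l j h1 h2)
  by_contra hne
  -- Start from a generalized weight vector outside `W`; apply `E`, then `H - l`, as often as
  -- possible without entering `W`.
  obtain ⟨l, u, huG, huW, hEu, hHu⟩ : ∃ (l : ℂ) (u : V), u ∈ H.maxGenEigenspace l ∧ u ∉ W ∧
      E u ∈ W ∧ H u - l • u ∈ W := by
    obtain ⟨l, x, hx, hxW⟩ : ∃ (l : ℂ) (x : V), x ∈ H.maxGenEigenspace l ∧ x ∉ W := by
      by_contra! hall
      refine hne (top_le_iff.1 ?_)
      rw [← End.iSup_maxGenEigenspace_eq_top H]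
      exact iSup_le fun l x hx => hall l x hx
    obtain ⟨l, x, hx, hxW, hEx⟩ : ∃ (l : ℂ) (x : V), x ∈ H.maxGenEigenspace l ∧ x ∉ W ∧
        E x ∈ W := by
      have hex : ∃ k, (E ^ k) x ∈ W := by
        obtain ⟨k, hk⟩ := exists_pow_apply_eq_zero (by norm_num) T.relHE hx
        exact ⟨k, by rw [hk]; exact W.zero_mem⟩
      obtain ⟨k, hk, hk'⟩ := Nat.exists_not_and_succ_of_not_zero_of_exists
        (p := fun k => (E ^ k) x ∈ W) (by simpa using hxW) hex
      rw [pow_succ', Module.End.mul_apply] at hk'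
      exact ⟨_, _, pow_apply_mem_maxGenEigenspace T.relHE hx k, hk, hk'⟩
    have hex : ∃ k, ((H - l • (1 : End ℂ V)) ^ k) x ∈ W := by
      obtain ⟨k, hk⟩ := (End.mem_maxGenEigenspace _ _ _).1 hx
      exact ⟨k, by rw [hk]; exact W.zero_mem⟩
    obtain ⟨k, hk, hk'⟩ := Nat.exists_not_and_succ_of_not_zero_of_exists
      (p := fun k => ((H - l • (1 : End ℂ V)) ^ k) x ∈ W) (by simpa using hxW) hex
    have hWpow : ∀ (m : ℂ) (k : ℕ) (y : V), y ∈ W → ((H - m • (1 : End ℂ V)) ^ k) y ∈ W := by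
      intro m k
      induction k with
      | zero => intro y hy; simpa using hy
      | succ k ih =>
        intro y hy
        rw [pow_succ, Module.End.mul_apply]
        refine ih _ ?_
        simpa using W.sub_mem (hH hy) (W.smul_mem m hy)
    refine ⟨l, _, ?_, hk, ?_, ?_⟩
    · obtain ⟨m, hm⟩ := (End.mem_maxGenEigenspace _ _ _).1 hx
      refine (End.mem_maxGenEigenspace _ _ _).2 ⟨m, ?_⟩
      rw [← Module.End.mul_apply, ← pow_add, add_comm, pow_add, Module.End.mul_apply, hm, map_zero]
    -- Moving `E` past `H - l` turns it into `H - (l + 2)`, which preserves `W`.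
    · rw [← sub_smul_pow_apply_shift T.relHE]
      exact hWpow _ _ _ hEx
    · rw [pow_succ', Module.End.mul_apply] at hk'
      simpa using hk'
  -- Closedness makes the quotient Hausdorff, as the highest weight lemma requires.
  have hclosed : IsClosed (W : Set V) := W.closed_of_finiteDimensional
  have : T3Space (V ⧸ W) := inferInstance
  obtain ⟨n, hn⟩ := (T.quotient hE hF hH).exists_sinh_eq_zero hħ (l := l) (v := W.mkQ u)
    (by simpa using huW)
    (by
      rw [← sub_eq_zero]
      simpa [← Submodule.Quotient.mk_smul, ← Submodule.Quotient.mk_sub,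
        Submodule.Quotient.mk_eq_zero] using hHu)
    (by simpa [Submodule.Quotient.mk_eq_zero] using hEu)
  -- The weight `l + 2` part of `W` is hit by `E` from its weight `l` part; all other weights go
  -- into the second summand.
  have key : W ≤ (W ⊓ H.maxGenEigenspace l).map E ⊔
      ⨆ μ, ⨆ (_ : μ ≠ l + 2), H.maxGenEigenspace μ := by
    refine Submodule.span_le.2 ?_
    rintro _ ⟨v, m, j, h1, h2, rfl⟩
    by_cases hμ : m - 2 * (j : ℂ) = l + 2
    · by_cases hv0 : v = 0
      · simp [hv0]
      obtain ⟨k, hk⟩ := T.exists_sinh_eq_zero hħ hv0 h1 h2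
      have hm : m = l + 2 + 2 * j := by rw [← hμ]; ring
      -- Vanishing would make `m` congruent to `j` modulo `πi/ħ`, but `m = l + 2 + 2j` is congruent
      -- to `n + 2 + 2j > j`.
      have hA : raiseCoeff ħ m j ≠ 0 := by
        intro hA
        rw [raiseCoeff_eq_zero_iff hħ] at hA
        have := int_eq_of_sinh_eq_zero hħ (l := m) (a := j) (b := 2 + 2 * j + n)
          (by simpa using hA) (by rw [hm, ← hn]; push_cast; ring_nf)
        omega
      refine Submodule.mem_sup_left ⟨((raiseCoeff ħ m j)⁻¹ * (Complex.sinh ħ * Complex.sinh ħ)) •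
        (F ^ (j + 1)) v, Submodule.smul_mem _ _ ⟨hsub v m (j + 1) h1 h2, ?_⟩, ?_⟩
      · have := T.apply_pow_lower_eigen h1 (j + 1)
        refine mem_maxGenEigenspace_of_apply ?_
        rw [this, hm]
        congr 1
        push_cast
        ring
      · rw [map_smul, mul_smul, T.raise_lower_eigen h1 h2, inv_smul_smul₀ hA]
    · refine Submodule.mem_sup_right (Submodule.mem_iSup_of_mem _ (Submodule.mem_iSup_of_mem hμ ?_))
      exact mem_maxGenEigenspace_of_apply (T.apply_pow_lower_eigen h1 j)
  obtain ⟨_, ⟨y, hy, rfl⟩, t, ht, hyt⟩ := Submodule.mem_sup.1 (key hEu)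
  have htG : t ∈ H.maxGenEigenspace (l + 2) := by
    have : t = E (u - y) := by rw [map_sub, ← hyt]; abel
    rw [this]
    exact apply_mem_maxGenEigenspace T.relHE (Submodule.sub_mem _ huG hy.2)
  have ht0 : t = 0 := (Submodule.disjoint_def.1 (H.independent_maxGenEigenspace (l + 2))) t htG ht
  have hker : u - y ∈ LinearMap.ker E := by
    rw [LinearMap.mem_ker, map_sub, ← hyt, ht0]
    abel
  have := W.add_mem (T.ker_le_highestWeightSpan hħ hker) hy.1
  rw [sub_add_cancel] at this
  exact huW this

end HighestWeight

/-! ### Strings of lowered vectors -/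

section LowerSpan

variable {V : Type*} [AddCommGroup V] [Module ℂ V]

/-- The span of `v, F v, …, F ^ n v`. -/
def lowerSpan (F : End ℂ V) (v : V) (n : ℕ) : Submodule ℂ V :=
  Submodule.span ℂ {x | ∃ j ≤ n, x = (F ^ j) v}

theorem pow_mem_lowerSpan {F : End ℂ V} {v : V} {j n : ℕ} (h : j ≤ n) :
    (F ^ j) v ∈ lowerSpan F v n :=
  Submodule.subset_span ⟨j, h, rfl⟩

end LowerSpan

/-! ### Irreducibility of the string of a highest weight vector -/

section Irreducible

variable {V : Type*} [AddCommGroup V] [Module ℂ V]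
  [TopologicalSpace V] [IsTopologicalAddGroup V] [ContinuousSMul ℂ V] [T2Space V]
  {ħ : ℂ} {E F H : End ℂ V}

/-- A submodule meeting the module generated by a highest weight vector contains the latter. -/
theorem IsOpTriple.mem_of_mem_lowerSpan (T : IsOpTriple ħ E F H)
    (hħ : ∀ n : ℕ, 0 < n → Complex.exp ħ ^ n ≠ 1) {l : ℂ} {v : V} (hv : H v = l • v)
    (hEv : E v = 0) {n : ℕ} (hn : Complex.sinh (ħ * (l - n)) = 0) {W : Submodule ℂ V}
    (hW : ∀ x ∈ W, E x ∈ W) {k : ℕ} (hk : k ≤ n) {x : V} (hx : x ∈ lowerSpan F v k) (hxW : x ∈ W)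
    (hx0 : x ≠ 0) : v ∈ W := by
  have hWpow : ∀ (k : ℕ), ∀ x ∈ W, (E ^ k) x ∈ W := by
    intro k
    induction k with
    | zero => intro x hx; simpa using hx
    | succ k ih => intro x hx; rw [pow_succ, Module.End.mul_apply]; exact ih _ (hW x hx)
  -- The raising coefficient at `j` vanishes only for `j = n`, so `d`, a product over indices below
  -- `j`, is nonzero up to `j = n`.
  have hlow : ∀ j, ∃ d : ℂ, (E ^ j) ((F ^ j) v) = d • v ∧ (j ≤ n → d ≠ 0) := by
    intro j
    induction j with
    | zero => exact ⟨1, by simp, by simp⟩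
    | succ j ih =>
      obtain ⟨d, hd, hd0⟩ := ih
      have hs := sinh_ne_zero hħ
      have h1 := T.raise_lower_eigen hv hEv j
      rw [← eq_inv_smul_iff₀ (mul_ne_zero hs hs)] at h1
      refine ⟨(Complex.sinh ħ * Complex.sinh ħ)⁻¹ * raiseCoeff ħ l j * d, ?_, fun hj => ?_⟩
      · rw [pow_succ E, Module.End.mul_apply, h1, map_smul, map_smul, hd]
        module
      · have hA : raiseCoeff ħ l j ≠ 0 := by
          intro hA
          rw [raiseCoeff_eq_zero_iff hħ] at hA
          have := int_eq_of_sinh_eq_zero hħ (a := j) (b := n) (by simpa using hA) (by simpa using hn)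
          omega
        exact mul_ne_zero (mul_ne_zero (inv_ne_zero (mul_ne_zero hs hs)) hA) (hd0 (by omega))
  have hkill : ∀ j, (E ^ (j + 1)) ((F ^ j) v) = 0 := by
    intro j
    obtain ⟨d, hd, -⟩ := hlow j
    rw [pow_succ', Module.End.mul_apply, hd, map_smul, hEv, smul_zero]
  induction k generalizing x with
  | zero =>
    have h1 : lowerSpan F v 0 ≤ Submodule.span ℂ {v} := by
      refine Submodule.span_mono ?_
      rintro _ ⟨j, hj, rfl⟩
      simp [Nat.le_zero.1 hj]
    obtain ⟨a, rfl⟩ := Submodule.mem_span_singleton.1 (h1 hx)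
    exact (W.smul_mem_iff (left_ne_zero_of_smul hx0)).1 hxW
  | succ k ih =>
    have h1 : lowerSpan F v (k + 1) ≤ Submodule.span ℂ {(F ^ (k + 1)) v} ⊔ lowerSpan F v k := by
      refine Submodule.span_le.2 ?_
      rintro _ ⟨j, hj, rfl⟩
      rcases hj.lt_or_eq with hj | rfl
      · exact Submodule.mem_sup_right (pow_mem_lowerSpan (by omega))
      · exact Submodule.mem_sup_left (Submodule.mem_span_singleton_self _)
    obtain ⟨_, hy, z, hz, rfl⟩ := Submodule.mem_sup.1 (h1 hx)
    obtain ⟨a, rfl⟩ := Submodule.mem_span_singleton.1 hy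
    by_cases ha : a = 0
    · rw [ha, zero_smul, zero_add] at hxW hx0
      exact ih (by omega) hz hxW hx0
    -- `E ^ (k+1)` kills the lower terms and turns the leading one into a nonzero multiple of `v`.
    · have hz0 : (E ^ (k + 1)) z = 0 := by
        have : lowerSpan F v k ≤ LinearMap.ker (E ^ (k + 1)) := by
          refine Submodule.span_le.2 ?_
          rintro _ ⟨j, hj, rfl⟩
          obtain ⟨i, rfl⟩ := Nat.exists_eq_add_of_le hj
          change (E ^ (j + i + 1)) ((F ^ j) v) = 0
          rw [show j + i + 1 = i + (j + 1) by ring, pow_add, Module.End.mul_apply, hkill, map_zero]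
        exact this hz
      have h2 := hWpow (k + 1) _ hxW
      obtain ⟨d, hd, hd0⟩ := hlow (k + 1)
      rw [map_add, map_smul, hz0, add_zero, hd] at h2
      exact (W.smul_mem_iff (hd0 hk)).1 ((W.smul_mem_iff ha).1 h2)

theorem IsOpTriple.lowerSpan_invariant [FiniteDimensional ℂ V] (T : IsOpTriple ħ E F H)
    (hħ : ∀ n : ℕ, 0 < n → Complex.exp ħ ^ n ≠ 1) {l : ℂ} {v : V} (hv : H v = l • v)
    (hEv : E v = 0) {n : ℕ} (hn : Complex.sinh (ħ * (l - n)) = 0) :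
    lowerSpan F v n ≤ (lowerSpan F v n).comap E ∧ lowerSpan F v n ≤ (lowerSpan F v n).comap F ∧
      lowerSpan F v n ≤ (lowerSpan F v n).comap H := by
  refine ⟨Submodule.span_le.2 ?_, Submodule.span_le.2 ?_, Submodule.span_le.2 ?_⟩
  · rintro _ ⟨j, hj, rfl⟩
    rcases j with _ | j
    · simp [hEv]
    · have hs := sinh_ne_zero hħ
      have h1 := T.raise_lower_eigen hv hEv j
      refine ((lowerSpan F v n).smul_mem_iff (mul_ne_zero hs hs)).1 ?_
      rw [h1]
      exact Submodule.smul_mem _ _ (pow_mem_lowerSpan (by omega))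
  · rintro _ ⟨j, hj, rfl⟩
    change F _ ∈ lowerSpan F v n
    rw [← Module.End.mul_apply, ← pow_succ']
    rcases hj.lt_or_eq with hj | rfl
    · exact pow_mem_lowerSpan (by omega)
    · rw [T.pow_lower_eq_zero hħ hv hEv hn]
      exact Submodule.zero_mem _
  · rintro _ ⟨j, hj, rfl⟩
    change H _ ∈ lowerSpan F v n
    rw [T.apply_pow_lower_eigen hv]
    exact Submodule.smul_mem _ _ (pow_mem_lowerSpan hj)

end Irreducible

/-! ### From modules over `Utilde ħ` to operators and back -/

section Representation

variable {ħ : ℂ} {V : Type*} [AddCommGroup V] [Module ℂ V] [TopologicalSpace V]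
  [Module (Utilde ħ) V] [IsScalarTower ℂ (Utilde ħ) V]

/-- The operator by which a generator acts. -/
noncomputable def genAction (ħ : ℂ) (V : Type*) [AddCommGroup V] [Module ℂ V] [Module (Utilde ħ) V]
    [IsScalarTower ℂ (Utilde ħ) V] (g : Gen) : End ℂ V :=
  Algebra.lsmul ℂ ℂ V (Utilde.gen ħ g)

/-- Continuity of each orbit map `a ↦ a • v` carries the `sinh` series from the algebra to `V`. -/
theorem isOpTriple_genAction [ContinuousSMul (Utilde ħ) V] :
    IsOpTriple ħ (genAction ħ V .E) (genAction ħ V .F) (genAction ħ V .H) where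
  relHE := by
    have := congrArg (Algebra.lsmul ℂ ℂ V) (Utilde.isTriple ħ).relHE
    simpa only [map_sub, map_mul, map_smul, genAction] using this
  relHF := by
    have := congrArg (Algebra.lsmul ℂ ℂ V) (Utilde.isTriple ħ).relHF
    simpa only [map_sub, map_mul, map_smul, genAction] using this
  relEF v := by
    have h := (Utilde.isTriple ħ).relEF.map
      ((Algebra.lsmul ℂ ℂ V : Utilde ħ →ₐ[ℂ] End ℂ V).toLinearMap.flip v)
      (continuous_id.smul continuous_const : Continuous fun a : Utilde ħ => a • v)
    have e : ∀ a : Utilde ħ, ((Algebra.lsmul ℂ ℂ V : Utilde ħ →ₐ[ℂ] End ℂ V).toLinearMap.flip v) a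
      = (Algebra.lsmul ℂ ℂ V a : End ℂ V) v := fun _ => rfl
    simpa only [Function.comp_def, e, map_sub, map_mul, map_smul, map_pow, LinearMap.smul_apply,
      genAction] using h

variable [IsTopologicalAddGroup V] [ContinuousSMul ℂ V] [T2Space V]

/-- A finite-dimensional subspace that is invariant under the generators is a submodule. -/
theorem smul_mem_of_gen_smul_mem [FiniteDimensional ℂ V] [ContinuousSMul (Utilde ħ) V]
    {L : Submodule ℂ V} (hL : ∀ g : Gen, L ≤ L.comap (genAction ħ V g)) (a : Utilde ħ) {x : V}
    (hx : x ∈ L) : a • x ∈ L := by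
  have hclosed : IsClosed (L : Set V) := L.closed_of_finiteDimensional
  -- `L` is closed and the free algebra is dense, so only noncommutative polynomials in the
  -- generators need checking.
  refine Completion.induction_on a
    (hclosed.preimage (continuous_id.smul continuous_const :
      Continuous fun a : Utilde ħ => a • x)) fun a => ?_
  change (a : Utilde ħ) • x ∈ L
  revert x
  refine FreeAlgebra.induction ℂ Gen
    (motive := fun a : PreU ħ => ∀ {x : V}, x ∈ L → ((a : PreU ħ) : Utilde ħ) • x ∈ L)
    ?_ ?_ ?_ ?_ a
  · intro r x hx
    have e : (((algebraMap ℂ (PreU ħ) r : PreU ħ) : Utilde ħ)) = algebraMap ℂ (Utilde ħ) r :=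
      (Completion.algebraMap_def (A := PreU ħ) (R := ℂ) r).symm
    change ((algebraMap ℂ (PreU ħ) r : PreU ħ) : Utilde ħ) • x ∈ L
    rw [e, algebraMap_smul]
    exact L.smul_mem r hx
  · intro g x hx
    exact hL g hx
  · intro (a : PreU ħ) (b : PreU ħ) ha hb x hx
    change ((a * b : PreU ħ) : Utilde ħ) • x ∈ L
    rw [Completion.coe_mul, mul_smul]
    exact ha (hb hx)
  · intro (a : PreU ħ) (b : PreU ħ) ha hb x hx
    change ((a + b : PreU ħ) : Utilde ħ) • x ∈ L
    rw [Completion.coe_add, add_smul]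
    exact L.add_mem (ha hx) (hb hx)

/-- The submodule generated by `v` lies in its finite string, where any nonzero vector can be raised
back to a nonzero multiple of `v`. -/
theorem isSimpleModule_span_highestWeight [FiniteDimensional ℂ V] [ContinuousSMul (Utilde ħ) V]
    (hħ : ∀ n : ℕ, 0 < n → Complex.exp ħ ^ n ≠ 1) {l : ℂ} {v : V} (h0 : v ≠ 0)
    (hv : genAction ħ V .H v = l • v) (hEv : genAction ħ V .E v = 0) :
    IsSimpleModule (Utilde ħ) (Submodule.span (Utilde ħ) {v}) := by
  have T := isOpTriple_genAction (ħ := ħ) (V := V)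
  obtain ⟨n, hn⟩ := T.exists_sinh_eq_zero hħ h0 hv hEv
  obtain ⟨hE, hF, hH⟩ := T.lowerSpan_invariant hħ hv hEv hn
  rw [isSimpleModule_iff_isAtom]
  refine ⟨by simpa using h0, fun W hW => ?_⟩
  by_contra hne
  obtain ⟨x, hxW, hx0⟩ := (Submodule.ne_bot_iff _).1 hne
  obtain ⟨a, rfl⟩ := Submodule.mem_span_singleton.1 (hW.le hxW)
  have hx : a • v ∈ lowerSpan (genAction ħ V .F) v n := by
    refine smul_mem_of_gen_smul_mem ?_ a (pow_mem_lowerSpan (j := 0) (Nat.zero_le n))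
    rintro (_ | _ | _)
    exacts [hE, hF, hH]
  have := T.mem_of_mem_lowerSpan hħ hv hEv hn (W := W.restrictScalars ℂ)
    (fun x hx => W.smul_mem _ hx) le_rfl hx hxW hx0
  exact hW.not_ge (Submodule.span_le.2 (Set.singleton_subset_iff.2 this))

end Representation

end QuantumSl2

/-! ### Complete reducibility -/

theorem theorem2p10 (ħ : ℂ) (hħ : ∀ n : ℕ, 0 < n → Complex.exp ħ ^ n ≠ 1)
    (V : Type*) [AddCommGroup V] [Module ℂ V] [FiniteDimensional ℂ V]
    [TopologicalSpace V] [IsTopologicalAddGroup V] [ContinuousSMul ℂ V] [T2Space V]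
    [Module (QuantumSl2.Utilde ħ) V] [IsScalarTower ℂ (QuantumSl2.Utilde ħ) V]
    [ContinuousSMul (QuantumSl2.Utilde ħ) V] :
    IsSemisimpleModule (QuantumSl2.Utilde ħ) V := by
  refine IsSemisimpleModule.of_sSup_simples_eq_top ?_
  set S : Submodule (QuantumSl2.Utilde ħ) V :=
    sSup {m | IsSimpleModule (QuantumSl2.Utilde ħ) m} with hS
  have T := QuantumSl2.isOpTriple_genAction (ħ := ħ) (V := V)
  have h : QuantumSl2.highestWeightSpan (QuantumSl2.genAction ħ V .E)
      (QuantumSl2.genAction ħ V .F) (QuantumSl2.genAction ħ V .H) ≤ S.restrictScalars ℂ := by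
    refine Submodule.span_le.2 ?_
    rintro _ ⟨v, l, j, hv, hEv, rfl⟩
    have hvS : v ∈ S := by
      by_cases h0 : v = 0
      · rw [h0]
        exact S.zero_mem
      · have hle : Submodule.span (QuantumSl2.Utilde ħ) {v} ≤ S :=
          le_sSup (QuantumSl2.isSimpleModule_span_highestWeight hħ h0 hv hEv)
        exact hle (Submodule.mem_span_singleton_self v)
    change _ ∈ S
    induction j with
    | zero => simpa using hvS
    | succ j ih =>
      rw [pow_succ', Module.End.mul_apply]
      exact S.smul_mem _ ih
  rw [T.highestWeightSpan_eq_top hħ] at h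
  exact eq_top_iff.2 fun x _ => h Submodule.mem_top
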